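/- **Setting.** Let $F$ be a non-empty set directed upward by a preorder $\le$ and let $(\mathcal H_\alpha, U_{\beta\alpha})$ be a directed contractive system of complex Hilbert spaces: for $\alpha\le\beta$, $U_{\beta\alpha}:\mathcal H_\alpha\to\mathcal H_\beta$ is linear, injective, $\|U_{\beta\alpha}x\|_\beta\le\|x\|_\alpha$, $U_{\alpha\alpha}=I$ and $U_{\gamma\alpha}=U_{\gamma\beta}U_{\beta\alpha}$ for $\alpha\le\beta\le\gamma$. Put $V_{\alpha\beta}=U_{\beta\alpha}^*$. Let $\mathcal D=\{(\xi_\alpha)\in\prod_\alpha\mathcal H_\alpha:\ \xi_\alpha=V_{\alpha\beta}\xi_\beta\ \text{for } \alpha\le\beta\}$ with projections $\Pi_\alpha$ and the projective topology $\mathsf t_p$, and let $\mathcal D^\times$ be the algebraic inductive limit of the $\mathcal H_\alpha$ along the $U_{\beta\alpha}$, with canonical maps $\Theta_\alpha:\mathcal H_\alpha\to\mathcal D^\times$ and the inductive topology $\mathsf t_i$ (the finest locally convex topology making all $\Theta_\alpha$ continuous). They are paired by $\langle\Theta_\alpha x,\xi\rangle=\langle x,\Pi_\alpha\xi\rangle_\alpha$,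 linear in the first and conjugate linear in the second variable. Assume that $(\mathcal D^\times,\mathcal D)$ is a conjugate dual pair, i.e. the pairing separates the points of $\mathcal D^\times$ (equivalently, every $\Pi_\alpha(\mathcal D)$ is dense in $\mathcal H_\alpha$). Put $\|\xi\|_0=\inf_\alpha\|\Pi_\alpha\xi\|_\alpha$ for $\xi\in\mathcal D$. Assume that $\|\cdot\|_0$ comes from a (semi-definite) inner product on $\mathcal D$ (this is automatic if $F$ is also directed downward), and let $\mathcal H_0$, with the canonical map $j:\mathcal D\to\mathcal H_0$, be the Hilbert space completion of $\mathcal D[\|\cdot\|_0]$. Assume: * (A) if $\xi\in\mathcal D$ and $\|\xi\|_0=0$, then $\xi=0$; * (C) for every $\alpha$ and every sequence $(\xi^n)$ in $\mathcal D$ with $\|\xi^n\|_0\to0$ such that $(\Pi_\alpha\xi^n)$ is Cauchy in $\mathcal H_\alpha$, one has $\Pi_\alpha\xi^n\to0$ in $\mathcal H_\alpha$. For a closable operator $A$ in $\mathcal H_0$ with dense domain, let $\mathcal H_A$ be the completion of its domain in the graph norm $\|\xi\|_A=(\|\xi\|_0^2+\|A\xi\|_0^2)^{1/2}$, realized in $\mathcal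 H_0$ as the domain of the closure $\bar A$. For operators with a common domain, $A\preceq B$ means $\|A\xi\|\le\|B\xi\|$ for all $\xi$ in the domain. **Theorem.** The map $j$ is injective, so that $\mathcal D$ is a dense subspace of $\mathcal H_0$, and there is an injective linear map $J:\mathcal H_0\to\mathcal D^\times$ with $\langle J\eta,\xi\rangle=\langle\eta,j\xi\rangle_0$. Moreover there are operators $A_\alpha$ ($\alpha\in F$) with domain $j(\mathcal D)$, closable in $\mathcal H_0$, and linear bijections $W_\alpha:\mathcal H_\alpha\to\mathcal H_{A_\alpha}$ such that: 1. For every $\alpha$, $\Pi_\alpha(\mathcal D)$ is dense in $\mathcal H_\alpha$, $W_\alpha\Pi_\alpha\xi=j\xi$ for $\xi\in\mathcal D$, the domain of $(I+A_\alpha^*\bar A_\alpha)^{1/2}$ is $\mathcal H_{A_\alpha}$, and $\|x\|_\alpha=\|W_\alpha x\|_{A_\alpha}=\|(I+A_\alpha^*\bar A_\alpha)^{1/2}W_\alpha x\|_0$ for all $x\in\mathcal H_\alpha$. That is, $\mathcal H_\alpha$ is the completion of $\mathcal D$ under $\|(I+A_\alpha^*\bar A_\alpha)^{1/2}\xi\|_0$.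 Under these identifications, $V_{\alpha\beta}$ is the inclusion $\mathcal H_{A_\beta}\subseteq\mathcal H_{A_\alpha}$ for $\alpha\le\beta$. 2. The family $\{A_\alpha\}$ is directed by $F$: if $\alpha\le\beta$ then $A_\alpha\preceq A_\beta$. Further, $A_\alpha\preceq A_\beta$ holds if and only if there is a linear contraction $U:\mathcal H_\alpha\to\mathcal H_\beta$ with $\Theta_\beta U=\Theta_\alpha$. 3. $j(\mathcal D)=\bigcap_\alpha\mathcal H_{A_\alpha}$, and $j$ carries $\mathsf t_p$ to the graph topology $\mathsf t_{\mathcal O}$ defined by the norms $\|\cdot\|_{A_\alpha}$. The pairing identifies $\mathcal D^\times$ linearly and bijectively with the conjugate dual of $\mathcal D[\mathsf t_{\mathcal O}]$ (the space of continuous conjugate linear functionals). Under this identification $\Theta_\alpha$ becomes the map $\Theta_{A_\alpha}:\mathcal H_{A_\alpha}\to\mathcal D^\times$, $\Theta_{A_\alpha}x=\langle x,\cdot\rangle_{A_\alpha}$, and $\mathcal D^\times=\bigcup_\alpha\Theta_{A_\alpha}(\mathcal H_{A_\alpha})$. So the rigged Hilbert space $(\mathcal D,\mathcal H_0,\mathcal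 D^\times)$ is the canonical one of the family $\{A_\alpha\}$. 4. The inductive topology $\mathsf t_i$ of $\mathcal D^\times$ is the Mackey topology $\tau(\mathcal D^\times,\mathcal D)$, i.e. the finest locally convex topology on $\mathcal D^\times$ whose continuous linear functionals are exactly the maps $\eta\mapsto\langle\eta,\xi\rangle$, $\xi\in\mathcal D$. -/

import Mathlib

open Topology Filter
open scoped InnerProductSpace

noncomputable section

/-! ## Unbounded operators -/

/-- The product `g f` of two partially defined operators, on its natural domain
`{x ∈ dom f | f x ∈ dom g}`. -/
def LinearPMap.natComp {K : Type*} [NormedAddCommGroup K] [InnerProductSpace ℂ K]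
    (g f : K →ₗ.[ℂ] K) : K →ₗ.[ℂ] K :=
  g.comp (f.domRestrict ((g.domain.comap f.toFun).map f.domain.subtype)) (by
    intro x
    obtain ⟨y, hy, hyx⟩ := Submodule.mem_map.1 x.2.1
    have h : f.domRestrict _ x = f y := LinearPMap.domRestrict_apply hyx.symm
    rw [h]
    exact hy)

/-- The operator `I + A* Ā`, where `Ā` is the closure of `A` (recall `A* = (Ā)*`). -/
def LinearPMap.onePlusAdjointClosure {K : Type*} [NormedAddCommGroup K] [InnerProductSpace ℂ K]
    [CompleteSpace K] (A : K →ₗ.[ℂ] K) : K →ₗ.[ℂ] K :=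
  (LinearMap.id : K →ₗ[ℂ] K) +ᵥ LinearPMap.natComp A.adjoint A.closure

/-- `T` is the square root `S^{1/2}`: the positive self-adjoint operator with `T T = S`,
domains included (there is at most one such operator). -/
def LinearPMap.IsPosSqrt {K : Type*} [NormedAddCommGroup K] [InnerProductSpace ℂ K]
    [CompleteSpace K] (T S : K →ₗ.[ℂ] K) : Prop :=
  IsSelfAdjoint T ∧ (∀ x : T.domain, 0 ≤ (⟪T x, (x : K)⟫_ℂ).re) ∧ LinearPMap.natComp T T = S

/-! ## Topologies on one side of a conjugate dual pair -/

/-- `t` is a locally convex vector space topology. -/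
def IsLCTopology {E : Type*} [AddCommGroup E] [Module ℂ E] (t : TopologicalSpace E) : Prop :=
  @IsTopologicalAddGroup E t _ ∧ @ContinuousSMul ℂ E _ _ t ∧ @LocallyConvexSpace ℝ E _ _ _ _ t

/-- A locally convex topology on `E` is compatible with the conjugate duality `B` of `E` and `G`
if the continuous linear functionals on `E` are exactly the functionals `B · ξ`, `ξ ∈ G`. -/
def IsCompatibleTopology {E G : Type*} [AddCommGroup E] [Module ℂ E] [AddCommGroup G] [Module ℂ G]
    (B : E →ₗ[ℂ] G →ₗ⋆[ℂ] ℂ) (t : TopologicalSpace E) : Prop :=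
  IsLCTopology t ∧
    ∀ f : E →ₗ[ℂ] ℂ, Continuous[t, inferInstance] f ↔ ∃ ξ : G, ∀ η : E, f η = B η ξ

/-- `t` is the Mackey topology `τ(E, G)`: the finest locally convex topology on `E` compatible
with the duality. (In Mathlib's order on topologies, finer means smaller.) -/
def IsMackeyTopology {E G : Type*} [AddCommGroup E] [Module ℂ E] [AddCommGroup G] [Module ℂ G]
    (B : E →ₗ[ℂ] G →ₗ⋆[ℂ] ℂ) (t : TopologicalSpace E) : Prop :=
  IsLeast {s : TopologicalSpace E | IsCompatibleTopology B s} t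

/-! ## Directed contractive systems and their joint topological limit -/

/-- A contractive system of Hilbert spaces over `F`. -/
structure ContractiveSystem (F : Type*) [Preorder F] (H : F → Type*)
    [∀ α, NormedAddCommGroup (H α)] [∀ α, InnerProductSpace ℂ (H α)] where
  U : ∀ α β : F, α ≤ β → H α →L[ℂ] H β
  injective : ∀ α β h, Function.Injective (U α β h)
  contractive : ∀ α β h x, ‖U α β h x‖ ≤ ‖x‖
  map_self : ∀ α x, U α α le_rfl x = x
  map_map : ∀ α β γ (h : α ≤ β) (h' : β ≤ γ) x, U β γ h' (U α β h x) = U α γ (h.trans h') x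

namespace ContractiveSystem

variable {F : Type*} [Preorder F] {H : F → Type*} [∀ α, NormedAddCommGroup (H α)]
  [∀ α, InnerProductSpace ℂ (H α)] [∀ α, CompleteSpace (H α)] (S : ContractiveSystem F H)

/-- `V_{αβ} = U_{βα}^*`. -/
def V (α β : F) (h : α ≤ β) : H β →L[ℂ] H α := ContinuousLinearMap.adjoint (S.U α β h)

/-- The projective limit `𝓓` of the spaces `H α` along the maps `V_{αβ}`. -/
def D : Submodule ℂ (∀ α, H α) where
  carrier := {ξ | ∀ α β (h : α ≤ β), ξ α = S.V α β h (ξ β)}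
  zero_mem' := by intro α β h; simp
  add_mem' := by
    intro ξ η hξ hη α β h
    simp [hξ α β h, hη α β h]
  smul_mem' := by
    intro c ξ hξ α β h
    simp [hξ α β h]

/-- The projection `Π_α : 𝓓 → H α`. -/
def proj (α : F) : S.D →ₗ[ℂ] H α := (LinearMap.proj α).comp S.D.subtype

/-- The projective topology `t_p` of `𝓓`: the coarsest topology making all `Π_α` continuous. -/
abbrev projectiveTopology : TopologicalSpace S.D :=
  ⨅ α, TopologicalSpace.induced (S.proj α) inferInstance

open Classical in
/-- `𝓓^×`, the algebraic inductive limit of the spaces `H α` along the maps `U_{βα}`. -/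
abbrev Dx (S : ContractiveSystem F H) : Type _ :=
  Module.DirectLimit H (fun α β h => (S.U α β h : H α →ₗ[ℂ] H β))

open Classical in
/-- The canonical map `Θ_α : H α → 𝓓^×`. -/
def Theta (α : F) : H α →ₗ[ℂ] S.Dx :=
  Module.DirectLimit.of ℂ F H (fun α β h => (S.U α β h : H α →ₗ[ℂ] H β)) α

/-- The conjugate linear functional `ξ ↦ ⟨η, Π_α ξ⟩_α` (inner product linear in `η`). -/
def pairingAux (α : F) : H α →ₗ[ℂ] S.D →ₗ⋆[ℂ] ℂ :=
  LinearMap.mk₂'ₛₗ (RingHom.id ℂ) (starRingEnd ℂ) (fun η ξ => ⟪S.proj α ξ, η⟫_ℂ)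
    (fun _ _ _ => inner_add_right _ _ _) (fun _ _ _ => inner_smul_right _ _ _)
    (fun _ _ _ => by rw [map_add, inner_add_left])
    (fun _ _ _ => by rw [map_smul, inner_smul_left]; rfl)

open Classical in
/-- The conjugate duality of `𝓓^×` and `𝓓`: the value `⟨η, ξ⟩` for `η = Θ_α x` is the inner
product of `x` and `Π_α ξ` in `H α`, linear in `η` and conjugate linear in `ξ`. -/
def pairing : S.Dx →ₗ[ℂ] S.D →ₗ⋆[ℂ] ℂ :=
  Module.DirectLimit.lift ℂ F H _ S.pairingAux (by
    intro α β h x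
    ext ξ
    change ⟪(ξ : ∀ α, H α) β, S.U α β h x⟫_ℂ = ⟪(ξ : ∀ α, H α) α, x⟫_ℂ
    rw [ξ.2 α β h, V, ContinuousLinearMap.adjoint_inner_left])

theorem pairing_Theta (α : F) (x : H α) (ξ : S.D) :
    S.pairing (S.Theta α x) ξ = ⟪S.proj α ξ, x⟫_ℂ := by
  classical
  unfold pairing Theta
  rw [Module.DirectLimit.lift_of]
  rfl

/-- The duality separates the points of `𝓓^×` (it always separates the points of `𝓓`), i.e.
`(𝓓^×, 𝓓)` is a conjugate dual pair. -/
def IsDualPair : Prop := ∀ η : S.Dx, (∀ ξ : S.D, S.pairing η ξ = 0) → η = 0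

/-- The inductive topology `t_i` of `𝓓^×`: the finest locally convex topology making all the maps
`Θ_α` continuous. -/
abbrev inductiveTopology : TopologicalSpace S.Dx :=
  sInf {t | IsLCTopology t ∧ ∀ α, Continuous[inferInstance, t] (S.Theta α)}

/-- `‖ξ‖₀ = inf_α ‖ξ_α‖_α`. -/
def norm₀ (ξ : S.D) : ℝ := ⨅ α, ‖S.proj α ξ‖

/-- Condition (A). -/
def CondA : Prop := ∀ ξ : S.D, S.norm₀ ξ = 0 → ξ = 0

/-- Condition (C), the compatibility of the norms. -/
def CondC : Prop :=
  ∀ (α : F) (ξ : ℕ → S.D), Tendsto (fun n => S.norm₀ (ξ n)) atTop (𝓝 0) →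
    CauchySeq (fun n => S.proj α (ξ n)) → Tendsto (fun n => S.proj α (ξ n)) atTop (𝓝 0)

/-- The Hilbert space `H₀`, with the linear map `j : 𝓓 → H₀`, is the completion of `𝓓` under
`‖·‖₀`. -/
def IsCompletion₀ {H₀ : Type*} [NormedAddCommGroup H₀] [InnerProductSpace ℂ H₀]
    (j : S.D →ₗ[ℂ] H₀) : Prop :=
  DenseRange j ∧ ∀ ξ, ‖j ξ‖ = S.norm₀ ξ

end ContractiveSystem

/-! ## O-families and their canonical rigged Hilbert space -/

/-- A family `(A_α)` of closable operators with a common dense domain in the Hilbert space `K`. -/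
structure OFamily (F : Type*) (K : Type*) [NormedAddCommGroup K] [InnerProductSpace ℂ K] where
  dom : Submodule ℂ K
  dense : Dense (dom : Set K)
  op : F → dom →ₗ[ℂ] K
  closable : ∀ α, LinearPMap.IsClosable (⟨dom, op α⟩ : K →ₗ.[ℂ] K)

namespace OFamily

variable {F : Type*} {K : Type*} [NormedAddCommGroup K] [InnerProductSpace ℂ K] (O : OFamily F K)

/-- `A_α` as a partially defined operator. -/
def pmap (α : F) : K →ₗ.[ℂ] K := ⟨O.dom, O.op α⟩

/-- The relation `A_α ⪯ A_β`. -/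
def Prec (α β : F) : Prop := ∀ ξ : O.dom, ‖O.op α ξ‖ ≤ ‖O.op β ξ‖

/-- The space `H_{A_α}`: the completion of the domain in the graph norm, realized in `K` as the
domain of the closure of `A_α` (this is possible as `A_α` is closable). -/
def HA (α : F) : Submodule ℂ K := (O.pmap α).closure.domain

/-- The closure of `A_α`. -/
def cl (α : F) : O.HA α →ₗ[ℂ] K := (O.pmap α).closure.toFun

/-- The map `x ↦ (x, Ā_α x)` into the Hilbert sum `K ⊕ K`. -/
def graphMap (α : F) : O.HA α →ₗ[ℂ] WithLp 2 (K × K) :=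
  (WithLp.linearEquiv 2 ℂ (K × K)).symm.toLinearMap.comp ((O.HA α).subtype.prod (O.cl α))

/-- The graph norm `‖x‖_{A_α} = (‖x‖² + ‖Ā_α x‖²)^{1/2}`. -/
def graphNorm (α : F) : Seminorm ℂ (O.HA α) :=
  (normSeminorm ℂ (WithLp 2 (K × K))).comp (O.graphMap α)

theorem graphNorm_apply (α : F) (x : O.HA α) :
    O.graphNorm α x = Real.sqrt (‖(x : K)‖ ^ 2 + ‖O.cl α x‖ ^ 2) :=
  WithLp.prod_norm_eq_of_L2 _

/-- `𝓓(O) = ⋂_α H_{A_α}`. -/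
def core : Submodule ℂ K := ⨅ α, O.HA α

/-- The inclusion `𝓓(O) → H_{A_α}`. -/
def coreIncl (α : F) : O.core →ₗ[ℂ] O.HA α :=
  Submodule.inclusion (iInf_le (fun α => O.HA α) α)

/-- The graph topology `t_O` on `𝓓(O)`, defined by the norms `‖·‖_{A_α}`. -/
abbrev graphTopology [Nonempty F] : TopologicalSpace O.core :=
  (SeminormFamily.moduleFilterBasis (𝕜 := ℂ)
    (fun α => (O.graphNorm α).comp (O.coreIncl α))).topology

/-- The conjugate dual of `𝓓(O)[t_O]`: the continuous conjugate linear functionals. -/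
def conjDual [Nonempty F] : Set (O.core →ₗ⋆[ℂ] ℂ) :=
  {f | Continuous[O.graphTopology, inferInstance] f}

/-- The map `Θ_{A_α}` sending `x ∈ H_{A_α}` to the conjugate linear functional
`ξ ↦ ⟨x, ξ⟩_{A_α} = ⟨x, ξ⟩ + ⟨Ā_α x, Ā_α ξ⟩` on `𝓓(O)` (inner products linear in `x`). -/
def Theta (α : F) : O.HA α →ₗ[ℂ] O.core →ₗ⋆[ℂ] ℂ :=
  LinearMap.mk₂'ₛₗ (RingHom.id ℂ) (starRingEnd ℂ)
    (fun x ξ => ⟪(ξ : K), (x : K)⟫_ℂ + ⟪O.cl α (O.coreIncl α ξ), O.cl α x⟫_ℂ)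
    (fun _ _ _ => by simp only [map_add, Submodule.coe_add, inner_add_right]; ring)
    (fun _ _ _ => by
      simp only [map_smul, Submodule.coe_smul, inner_smul_right, smul_eq_mul, RingHom.id_apply]
      ring)
    (fun _ _ _ => by simp only [map_add, Submodule.coe_add, inner_add_left]; ring)
    (fun _ _ _ => by
      simp only [map_smul, Submodule.coe_smul, inner_smul_left, smul_eq_mul]
      ring)

end OFamily

end

/-!
The projections `Π_α : 𝓓 → H α` have dense range, because a vector orthogonal to `Π_α(𝓓)` is killed
by `Θ_α` in a dual pair, and `Θ_α` is injective. As `‖j ξ‖ ≤ ‖Π_α ξ‖`, the assignment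
`Π_α ξ ↦ j ξ` extends to a contraction `W_α : H α → H₀` (`toCompletion`) with dense range, and
condition (C) is the statement that `W_α` is injective (`injective_toCompletion`). The spaces `H α`
thus become subspaces of `H₀`, with `V_{αβ}` the inclusions, and the intersection of these subspaces
is `j(𝓓)`, since a vector of the intersection defines a compatible family.

The operators `A_α` come from the polar decomposition `W_α = R P` with `P : H α → H₀` unitary and
`R = (W_α W_α*)^{1/2}` (`ContinuousLinearMap.exists_polar`). With `C = (I - R²)^{1/2}`, the operator
`C R⁻¹` on the range of `R`, which is the range of `W_α`, is closed, and its graph norm at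
`W_α x = R P x` is `(‖R P x‖² + ‖C P x‖²)^{1/2} = ‖x‖`. Let `A_α` be its restriction to `j(𝓓)`. Density
of `Π_α(𝓓)` gives `Ā_α = C R⁻¹` (`closure_eq_mulInv`), and comparing graphs gives
`I + A_α* Ā_α = R⁻¹ R⁻¹`, so that the positive square root is `R⁻¹`
(`isPosSqrt_onePlusAdjointClosure`).

The rest is duality. The relation `A_α ⪯ A_β` means `‖Π_α ξ‖ ≤ ‖Π_β ξ‖` for all `ξ`; then
`Π_β ξ ↦ Π_α ξ` extends to a contraction, whose adjoint is the required map `H α → H β`. A continuous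
conjugate linear functional on `𝓓` is bounded by one norm `‖Π_α ·‖`, as the index set is directed, and
is an element of `H α` by the Riesz theorem. A linear functional on `𝓓^×` that is continuous along
all `Θ_α` is a point of `𝓓`, again by the Riesz theorem. Hence the inductive topology is compatible
with the duality. It is the finest such topology because weakly continuous linear maps from a Banach
space to a locally convex space are continuous (`IsLCTopology.continuous_of_forall_functional`).
-/

noncomputable section

/-! ### Operators of the form `C R⁻¹` -/

namespace LinearPMap

variable {K : Type*} [NormedAddCommGroup K] [InnerProductSpace ℂ K]

theorem mem_graph_natComp {g f : K →ₗ.[ℂ] K} {p : K × K} :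
    p ∈ (natComp g f).graph ↔ ∃ y, (p.1, y) ∈ f.graph ∧ (y, p.2) ∈ g.graph := by
  obtain ⟨x, z⟩ := p
  rw [mem_graph_iff]
  constructor
  · rintro ⟨⟨x', hx'⟩, rfl, rfl⟩
    obtain ⟨y, hy, hyx⟩ := Submodule.mem_map.1 hx'.1
    refine ⟨f y, ?_, ?_⟩
    · have := f.mem_graph y
      rwa [show (y : K) = x' from hyx] at this
    · rw [mem_graph_iff]
      refine ⟨⟨f y, hy⟩, rfl, ?_⟩
      change _ = g _
      congr 1
      apply Subtype.ext
      have h : f.domRestrict ((g.domain.comap f.toFun).map f.domain.subtype) ⟨x', hx'⟩ = f y :=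
        domRestrict_apply hyx.symm
      exact h.symm
  · rintro ⟨y, hxy, hyz⟩
    obtain ⟨x', rfl, rfl⟩ := (mem_graph_iff _).1 hxy
    obtain ⟨y', hy', hz'⟩ := (mem_graph_iff _).1 hyz
    have hmem : f x' ∈ g.domain := by
      have := y'.2
      rwa [hy'] at this
    refine ⟨⟨x', ⟨Submodule.mem_map.2 ⟨x', hmem, rfl⟩, x'.2⟩⟩, rfl, ?_⟩
    dsimp only at hz'
    rw [← hz']
    change g _ = _
    congr 1
    apply Subtype.ext
    rw [hy']
    have h (hx) : f.domRestrict ((g.domain.comap f.toFun).map f.domain.subtype) ⟨x', hx⟩ = f x' :=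
      domRestrict_apply rfl
    exact h _

theorem mem_graph_id_vadd {f : K →ₗ.[ℂ] K} {p : K × K} :
    p ∈ ((LinearMap.id : K →ₗ[ℂ] K) +ᵥ f).graph ↔ (p.1, p.2 - p.1) ∈ f.graph := by
  obtain ⟨x, z⟩ := p
  simp only [mem_graph_iff]
  constructor
  · rintro ⟨y, rfl, rfl⟩
    exact ⟨y, rfl, by rw [vadd_apply]; simp⟩
  · rintro ⟨y, rfl, h⟩
    exact ⟨y, rfl, by rw [vadd_apply, h]; simp⟩

theorem mem_graph_adjoint [CompleteSpace K] {T : K →ₗ.[ℂ] K} (hT : Dense (T.domain : Set K))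
    {p : K × K} :
    p ∈ T.adjoint.graph ↔ ∀ a b, (a, b) ∈ T.graph → ⟪b, p.1⟫_ℂ = ⟪a, p.2⟫_ℂ := by
  simp only [adjoint_graph_eq_graph_adjoint hT, Submodule.mem_adjoint_iff, sub_eq_zero]

theorem adjoint_closure_eq [CompleteSpace K] {T : K →ₗ.[ℂ] K} (hT : Dense (T.domain : Set K))
    (hc : T.IsClosable) : T.closure.adjoint = T.adjoint := by
  apply eq_of_eq_graph
  ext p
  rw [mem_graph_adjoint hT, mem_graph_adjoint (hT.mono T.le_closure.1)]
  refine ⟨fun h a b hab => h a b (le_graph_of_le T.le_closure hab), fun h a b hab => ?_⟩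
  rw [← hc.graph_closure_eq_closure_graph] at hab
  have hcl : _root_.IsClosed {q : K × K | ⟪q.2, p.1⟫_ℂ = ⟪q.1, p.2⟫_ℂ} :=
    isClosed_eq (by fun_prop) (by fun_prop)
  exact closure_minimal (fun q hq => h q.1 q.2 hq) hcl hab

/-- The operator `C R⁻¹` with domain the range of `R`, for everywhere defined bounded operators
`C` and `R`, the latter injective. -/
def mulInv (C R : K →L[ℂ] K) (hR : Function.Injective R) : K →ₗ.[ℂ] K where
  domain := LinearMap.range (R : K →ₗ[ℂ] K)
  toFun := (C : K →ₗ[ℂ] K) ∘ₗ (LinearEquiv.ofInjective (R : K →ₗ[ℂ] K) hR).symm.toLinearMap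

section mulInv

variable {C R : K →L[ℂ] K} {hR : Function.Injective R}

theorem mulInv_apply (y : K) (h : R y ∈ (mulInv C R hR).domain) :
    mulInv C R hR ⟨R y, h⟩ = C y := by
  change C ((LinearEquiv.ofInjective (R : K →ₗ[ℂ] K) hR).symm ⟨R y, h⟩) = C y
  congr 1
  rw [LinearEquiv.symm_apply_eq]
  rfl

theorem mem_graph_mulInv {p : K × K} :
    p ∈ (mulInv C R hR).graph ↔ ∃ y, R y = p.1 ∧ C y = p.2 := by
  rw [mem_graph_iff]
  constructor
  · rintro ⟨⟨_, y, rfl⟩, h1, h2⟩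
    exact ⟨y, h1, (mulInv_apply y _).symm.trans h2⟩
  · rintro ⟨y, h1, h2⟩
    exact ⟨⟨R y, y, rfl⟩, h1, (mulInv_apply y _).trans h2⟩

theorem dense_domain_mulInv (hd : DenseRange R) : Dense ((mulInv C R hR).domain : Set K) := hd

/-- The point `y` is recovered from the pair `(R y, C y)` as `R (R y) + C (C y)`, which describes
the graph of `C R⁻¹` by a closed condition. -/
theorem isClosed_mulInv (hRC : ∀ y, R (R y) + C (C y) = y) : (mulInv C R hR).IsClosed := by
  have : ((mulInv C R hR).graph : Set (K × K)) =
      {p | R (R p.1 + C p.2) = p.1} ∩ {p | C (R p.1 + C p.2) = p.2} := by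
    ext p
    rw [SetLike.mem_coe, mem_graph_mulInv]
    constructor
    · rintro ⟨y, h1, h2⟩
      simp only [Set.mem_inter_iff, Set.mem_ofPred_eq, ← h1, ← h2, hRC, and_self]
    · rintro ⟨h1, h2⟩
      exact ⟨_, h1, h2⟩
  unfold LinearPMap.IsClosed
  rw [this]
  exact (isClosed_eq (by fun_prop) (by fun_prop)).inter (isClosed_eq (by fun_prop) (by fun_prop))

section restriction

variable {V : Type*} {A : K →ₗ.[ℂ] K} {k : V → K}

theorem isClosable_of_graph_eq (hR : Function.Injective R) (hRC : ∀ y, R (R y) + C (C y) = y)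
    (hA : ∀ p, p ∈ A.graph ↔ ∃ v, R (k v) = p.1 ∧ C (k v) = p.2) : A.IsClosable := by
  refine (isClosed_mulInv (hR := hR) hRC).isClosable.leIsClosable (le_of_le_graph fun p hp => ?_)
  obtain ⟨v, hv⟩ := (hA p).1 hp
  exact mem_graph_mulInv.2 ⟨_, hv⟩

/-- If `k` has dense range, the restriction of `C R⁻¹` to the vectors `R (k v)` has closure
`C R⁻¹`. -/
theorem closure_eq_mulInv (hRC : ∀ y, R (R y) + C (C y) = y) (hk : DenseRange k)
    (hA : ∀ p, p ∈ A.graph ↔ ∃ v, R (k v) = p.1 ∧ C (k v) = p.2) :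
    A.closure = mulInv C R hR := by
  apply eq_of_eq_graph
  rw [← (isClosable_of_graph_eq hR hRC hA).graph_closure_eq_closure_graph]
  apply le_antisymm
  · refine A.graph.topologicalClosure_minimal (fun p hp => ?_) (isClosed_mulInv hRC)
    obtain ⟨v, hv⟩ := (hA p).1 hp
    exact mem_graph_mulInv.2 ⟨_, hv⟩
  · intro p hp
    obtain ⟨y, h1, h2⟩ := mem_graph_mulInv.1 hp
    have hcont : Continuous fun y => (R y, C y) := by fun_prop
    have := map_mem_closure hcont (hk y) (t := A.graph) (by
      rintro _ ⟨v, rfl⟩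
      exact (hA _).2 ⟨v, rfl, rfl⟩)
    rwa [h1, h2] at this

end restriction

theorem isSelfAdjoint_mulInv_one [CompleteSpace K] (hsa : IsSelfAdjoint R) (hd : DenseRange R) :
    IsSelfAdjoint (mulInv 1 R hR) := by
  rw [isSelfAdjoint_def]
  apply eq_of_eq_graph
  ext p
  have hsym := ContinuousLinearMap.isSelfAdjoint_iff_isSymmetric.1 hsa
  rw [mem_graph_adjoint (dense_domain_mulInv hd), mem_graph_mulInv]
  constructor
  · intro h
    refine ⟨p.2, ?_, rfl⟩
    refine ext_inner_left ℂ fun v => ?_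
    have h1 := h (R v) v (mem_graph_mulInv.2 ⟨v, rfl, rfl⟩)
    rw [h1]
    exact (hsym v p.2).symm
  · rintro ⟨y, h1, h2⟩ a b hab
    obtain ⟨v, rfl, rfl⟩ := mem_graph_mulInv.1 hab
    rw [← h1, ← h2]
    exact (hsym v y).symm

/-- If `R² + C² = I` and the closure of `A` is `C R⁻¹`, then `I + A* Ā = R⁻¹ R⁻¹`: the vector
`C y` lies in the domain of `A*` exactly when `C (C y) = y - R (R y)` is in the range of `R`. -/
theorem isPosSqrt_onePlusAdjointClosure [CompleteSpace K] {A : K →ₗ.[ℂ] K}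
    (hA : Dense (A.domain : Set K)) (hc : A.IsClosable) (hcl : A.closure = mulInv C R hR)
    (hRp : R.IsPositive) (hC : IsSelfAdjoint C) (hd : DenseRange R)
    (hRC : ∀ y, R (R y) + C (C y) = y) :
    IsPosSqrt (mulInv 1 R hR) A.onePlusAdjointClosure := by
  refine ⟨isSelfAdjoint_mulInv_one hRp.isSelfAdjoint hd, ?_, ?_⟩
  · rintro ⟨_, y, rfl⟩
    have := hRp.re_inner_nonneg_right y
    rw [show mulInv 1 R hR ⟨_, y, rfl⟩ = y from mulInv_apply y ⟨y, rfl⟩]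
    exact this
  · have hRs := ContinuousLinearMap.isSelfAdjoint_iff_isSymmetric.1 hRp.isSelfAdjoint
    have hCs := ContinuousLinearMap.isSelfAdjoint_iff_isSymmetric.1 hC
    have key : ∀ y z : K, (C y, z) ∈ A.adjoint.graph ↔ C (C y) = R z := by
      intro y z
      rw [← adjoint_closure_eq hA hc, hcl, mem_graph_adjoint (dense_domain_mulInv hd)]
      constructor
      · intro h
        refine ext_inner_left ℂ fun v => ?_
        have h1 := h (R v) (C v) (mem_graph_mulInv.2 ⟨v, rfl, rfl⟩)
        exact ((hCs v (C y)).symm.trans h1).trans (hRs v z)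
      · rintro h a b hab
        obtain ⟨v, rfl, rfl⟩ := mem_graph_mulInv.1 hab
        have h1 := congrArg (fun w => ⟪v, w⟫_ℂ) h
        exact ((hCs v (C y)).trans h1).trans (hRs v z).symm
    apply eq_of_eq_graph
    ext ⟨x, z⟩
    unfold onePlusAdjointClosure
    rw [mem_graph_id_vadd, mem_graph_natComp, mem_graph_natComp, hcl]
    simp only [mem_graph_mulInv, one_apply_eq_self]
    constructor
    · rintro ⟨y, ⟨_, hx, rfl⟩, _, hz, rfl⟩
      refine ⟨C _, ⟨_, hx, rfl⟩, (key _ _).2 ?_⟩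
      rw [R.map_sub, hz, ← hx, eq_sub_iff_add_eq']
      exact hRC _
    · rintro ⟨_, ⟨y, hx, rfl⟩, h⟩
      refine ⟨y, ⟨y, hx, rfl⟩, z, ?_, rfl⟩
      have h1 := (key _ _).1 h
      rw [R.map_sub, ← hx, eq_sub_iff_add_eq', hRC] at h1
      exact h1.symm

end mulInv

end LinearPMap

theorem norm_sq_add_norm_sq_of_comp_add_comp {K : Type*} [NormedAddCommGroup K]
    [InnerProductSpace ℂ K] [CompleteSpace K] {R C : K →L[ℂ] K} (hR : IsSelfAdjoint R)
    (hC : IsSelfAdjoint C) (hRC : ∀ y, R (R y) + C (C y) = y) (y : K) :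
    ‖R y‖ ^ 2 + ‖C y‖ ^ 2 = ‖y‖ ^ 2 := by
  have hRs := ContinuousLinearMap.isSelfAdjoint_iff_isSymmetric.1 hR
  have hCs := ContinuousLinearMap.isSelfAdjoint_iff_isSymmetric.1 hC
  have h : ⟪R y, R y⟫_ℂ + ⟪C y, C y⟫_ℂ = ⟪y, y⟫_ℂ := by
    refine (congrArg₂ (· + ·) (hRs y (R y)) (hCs y (C y))).trans ?_
    rw [← inner_add_right]
    exact congrArg (fun w => ⟪y, w⟫_ℂ) (hRC y)
  simp only [inner_self_eq_norm_sq_to_K] at h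
  exact_mod_cast h

/-! ### Polar decomposition of an injective contraction -/

/-- Polar decomposition of the adjoint of an injective contraction `W` with dense range, in the
form needed here: `W = R P` with `P` unitary and `R = (W W*)^{1/2}`, together with
`C = (I - W W*)^{1/2}`. -/
theorem ContinuousLinearMap.exists_polar {E K : Type*} [NormedAddCommGroup E]
    [InnerProductSpace ℂ E] [CompleteSpace E] [NormedAddCommGroup K] [InnerProductSpace ℂ K]
    [CompleteSpace K] (W : E →L[ℂ] K) (hinj : Function.Injective W) (hd : DenseRange W)
    (hW : ∀ x, ‖W x‖ ≤ ‖x‖) :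
    ∃ (R C : K →L[ℂ] K) (P : E ≃ₗᵢ[ℂ] K), R.IsPositive ∧ IsSelfAdjoint C ∧
      (∀ y, R (R y) + C (C y) = y) ∧ ∀ x, R (P x) = W x := by
  set B : K →L[ℂ] K := W ∘L adjoint W with hB
  have hBpos : 0 ≤ B := by
    rw [ContinuousLinearMap.nonneg_iff_isPositive]
    exact ContinuousLinearMap.isPositive_self_comp_adjoint W
  have hW' : ∀ y, ‖adjoint W y‖ ≤ ‖y‖ := fun y => by
    refine (adjoint W).le_of_opNorm_le (c := 1) ?_ y |>.trans_eq (one_mul _)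
    rw [LinearIsometryEquiv.norm_map]
    exact W.opNorm_le_bound zero_le_one fun x => by simpa using hW x
  have hinnerB : ∀ x, ⟪B x, x⟫_ℂ = ((‖adjoint W x‖ ^ 2 : ℝ) : ℂ) := fun x => by
    rw [hB, ContinuousLinearMap.comp_apply, ← ContinuousLinearMap.adjoint_inner_right,
      inner_self_eq_norm_sq_to_K]
    norm_cast
  have hBle : 0 ≤ 1 - B := by
    rw [ContinuousLinearMap.nonneg_iff_isPositive, ContinuousLinearMap.isPositive_iff_complex]
    intro x
    have h : ⟪(1 - B) x, x⟫_ℂ = ((‖x‖ ^ 2 - ‖adjoint W x‖ ^ 2 : ℝ) : ℂ) := by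
      rw [sub_apply, inner_sub_left, hinnerB, one_apply_eq_self,
        inner_self_eq_norm_sq_to_K]
      push_cast
      rfl
    rw [h]
    refine ⟨by simp only [RCLike.re_to_complex, Complex.ofReal_re], ?_⟩
    rw [RCLike.re_to_complex, Complex.ofReal_re]
    exact sub_nonneg.2 (pow_le_pow_left₀ (norm_nonneg _) (hW' x) 2)
  set R := CFC.sqrt B
  set C := CFC.sqrt (1 - B)
  have hR : R.IsPositive := (ContinuousLinearMap.nonneg_iff_isPositive _).1 (CFC.sqrt_nonneg _)
  have hC : C.IsPositive := (ContinuousLinearMap.nonneg_iff_isPositive _).1 (CFC.sqrt_nonneg _)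
  have hRs := ContinuousLinearMap.isSelfAdjoint_iff_isSymmetric.1 hR.isSelfAdjoint
  have hRR : ∀ y, R (R y) = B y := fun y =>
    congrArg (fun T : K →L[ℂ] K => T y) (CFC.sqrt_mul_sqrt_self B hBpos)
  have hCC : ∀ y, C (C y) = y - B y := fun y =>
    congrArg (fun T : K →L[ℂ] K => T y) (CFC.sqrt_mul_sqrt_self (1 - B) hBle)
  have hnorm : ∀ y, ‖R y‖ = ‖adjoint W y‖ := fun y => by
    have h1 : ⟪R y, R y⟫_ℂ = ⟪adjoint W y, adjoint W y⟫_ℂ := by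
      refine (hRs y (R y)).trans ?_
      rw [ContinuousLinearMap.adjoint_inner_left]
      exact congrArg (fun w => ⟪y, w⟫_ℂ) (hRR y)
    rw [inner_self_eq_norm_sq_to_K, inner_self_eq_norm_sq_to_K] at h1
    norm_cast at h1
    exact (sq_eq_sq₀ (norm_nonneg _) (norm_nonneg _)).1 h1
  -- The adjoint of an injective operator has dense range, and `R` has dense range as `R² = W W*`.
  have hd' : DenseRange (adjoint W) := by
    have h := W.orthogonal_ker
    rw [LinearMap.ker_eq_bot.2 hinj, Submodule.bot_orthogonal_eq_top] at h
    have := (Submodule.dense_iff_topologicalClosure_eq_top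
      (s := LinearMap.range (adjoint W : K →ₗ[ℂ] E))).2 h.symm
    exact this
  have hdR : DenseRange R := by
    have h2 : DenseRange (fun y => R (R y)) := by
      have : (fun y => R (R y)) = W ∘ adjoint W := funext hRR
      rw [this]
      exact hd.comp hd' W.continuous
    exact h2.mono (by rintro _ ⟨y, rfl⟩; exact ⟨R y, rfl⟩)
  let P : E ≃ₗᵢ[ℂ] K := (LinearEquiv.refl ℂ K).extendOfIsometry
    (adjoint W : K →ₗ[ℂ] E) (R : K →ₗ[ℂ] K) hd' hdR hnorm
  have hP : ∀ y, P (adjoint W y) = R y := fun y =>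
    (LinearEquiv.refl ℂ K).extendOfIsometry_eq
      (adjoint W : K →ₗ[ℂ] E) (R : K →ₗ[ℂ] K) hd' hdR hnorm y
  refine ⟨R, C, P, hR, hC.isSelfAdjoint, fun y => by rw [hRR, hCC]; abel, fun x => ?_⟩
  refine ext_inner_left ℂ fun y => ?_
  rw [← ContinuousLinearMap.adjoint_inner_left W, ← P.inner_map_map, hP]
  exact (hRs y (P x)).symm

/-! ### Locally convex topologies and the Mackey topology -/

theorem IsLCTopology.sInf {E : Type*} [AddCommGroup E] [Module ℂ E] {ts : Set (TopologicalSpace E)}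
    (h : ∀ t ∈ ts, IsLCTopology t) : IsLCTopology (sInf ts) :=
  ⟨topologicalAddGroup_sInf fun t ht => (h t ht).1, continuousSMul_sInf fun t ht => (h t ht).2.1,
    LocallyConvexSpace.sInf fun t ht => (h t ht).2.2⟩

theorem IsLCTopology.induced {E : Type*} [AddCommGroup E] [Module ℂ E] (f : E →ₗ[ℂ] ℂ) :
    IsLCTopology (TopologicalSpace.induced f inferInstance) :=
  ⟨topologicalAddGroup_induced f, continuousSMul_induced f,
    LocallyConvexSpace.induced (f.restrictScalars ℝ)⟩

theorem LocallyConvexSpace.complex_of_real {E : Type*} [AddCommGroup E] [Module ℂ E]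
    [TopologicalSpace E] [LocallyConvexSpace ℝ E] :
    letI := Complex.partialOrder
    LocallyConvexSpace ℂ E := by
  let := Complex.partialOrder
  refine ⟨fun x => ?_⟩
  simpa only [convex_RCLike_iff_convex_real (K := ℂ)] using
    LocallyConvexSpace.convex_basis (𝕜 := ℝ) x

/-- A weakly continuous linear map from a Banach space to a locally convex space is continuous:
by the Hahn-Banach theorem, a continuous seminorm composed with the map is lower semicontinuous,
and a Banach space is barrelled. -/
theorem IsLCTopology.continuous_of_forall_functional {X E : Type*} [NormedAddCommGroup X]
    [NormedSpace ℂ X] [CompleteSpace X] [AddCommGroup E] [Module ℂ E] [t : TopologicalSpace E]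
    (ht : IsLCTopology t) (T : X →ₗ[ℂ] E)
    (h : ∀ f : E →ₗ[ℂ] ℂ, Continuous f → Continuous fun x => f (T x)) : Continuous T := by
  obtain ⟨_, _, _⟩ := ht
  let := Complex.partialOrder
  have : LocallyConvexSpace ℂ E := LocallyConvexSpace.complex_of_real
  have : ContinuousSMul ℝ E := IsScalarTower.continuousSMul ℂ
  refine WithSeminorms.continuous_of_continuous_comp (PolynormableSpace.withSeminorms ℂ E) T ?_
  rintro ⟨p, hp⟩
  refine Seminorm.continuous_of_lowerSemicontinuous _ ?_
  rw [lowerSemicontinuous_iff_isClosed_preimage]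
  intro c
  rw [← isOpen_compl_iff, isOpen_iff_mem_nhds]
  intro x hx
  have hconv : Convex ℝ {y | p y ≤ c} := by
    simpa using (p.restrictScalars ℝ).convexOn.convex_le c
  have hclosed : IsClosed {y | p y ≤ c} := isClosed_le hp continuous_const
  obtain ⟨f, u, hf, hu⟩ :=
    RCLike.geometric_hahn_banach_closed_point (𝕜 := ℂ) hconv hclosed (x := T x) hx
  have hcont : Continuous fun x => RCLike.re (f (T x)) :=
    RCLike.continuous_re.comp (h f f.continuous)
  filter_upwards [hcont.continuousAt.eventually (lt_mem_nhds hu)] with y hy hy'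
  exact lt_asymm hy (hf _ hy')

/-- Let `E` carry the finest locally convex topology making linear maps `T i` from Banach spaces
continuous, and let the functionals `B · ξ` be exactly the linear functionals whose compositions
with all `T i` are continuous. Then this topology is the Mackey topology. -/
theorem isMackeyTopology_sInf {ι : Type*} {X : ι → Type*} [∀ i, NormedAddCommGroup (X i)]
    [∀ i, NormedSpace ℂ (X i)] [∀ i, CompleteSpace (X i)] {E G : Type*} [AddCommGroup E]
    [Module ℂ E] [AddCommGroup G] [Module ℂ G] (B : E →ₗ[ℂ] G →ₗ⋆[ℂ] ℂ)
    (T : ∀ i, X i →ₗ[ℂ] E)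
    (hB : ∀ f : E →ₗ[ℂ] ℂ, (∀ i, Continuous fun x => f (T i x)) ↔ ∃ ξ : G, ∀ η, f η = B η ξ) :
    IsMackeyTopology B
      (sInf {t | IsLCTopology t ∧ ∀ i, Continuous[inferInstance, t] (T i)}) := by
  refine ⟨⟨IsLCTopology.sInf fun t ht => ht.1, fun f => ?_⟩, ?_⟩
  · rw [← hB f]
    constructor
    · intro hf i
      exact @Continuous.comp _ _ _ _ (_) _ _ _ hf (continuous_sInf_rng.2 fun t ht => ht.2 i)
    · intro hf
      exact continuous_sInf_dom (t := TopologicalSpace.induced f inferInstance)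
        ⟨IsLCTopology.induced f, fun i => continuous_induced_rng.2 (hf i)⟩ continuous_induced_dom
  · rintro s ⟨hs, hs'⟩
    refine sInf_le ⟨hs, fun i => ?_⟩
    refine IsLCTopology.continuous_of_forall_functional (t := s) hs (T i) fun f hf => ?_
    exact (hB f).2 ((hs' f).1 hf) i

/-! ### Limits of contractive systems and their duality -/

namespace ContractiveSystem

variable {F : Type*} [Preorder F] {H : F → Type*} [∀ α, NormedAddCommGroup (H α)]
  [∀ α, InnerProductSpace ℂ (H α)] (S : ContractiveSystem F H)

theorem Theta_U {α β : F} (h : α ≤ β) (x : H α) : S.Theta β (S.U α β h x) = S.Theta α x := by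
  classical
  exact Module.DirectLimit.of_f

theorem exists_Theta_eq [IsDirectedOrder F] [Nonempty F] (η : S.Dx) : ∃ α x, S.Theta α x = η := by
  classical
  exact Module.DirectLimit.exists_of η

theorem Theta_injective [IsDirectedOrder F] (α : F) : Function.Injective (S.Theta α) := by
  classical
  have : DirectedSystem H (fun α β h => (S.U α β h : H α →ₗ[ℂ] H β)) :=
    ⟨S.map_self, fun _ _ _ h h' x => S.map_map _ _ _ h h' x⟩
  rw [injective_iff_map_eq_zero]
  intro x hx
  obtain ⟨β, h, hβ⟩ := Module.DirectLimit.of.zero_exact hx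
  exact S.injective α β h (hβ.trans (map_zero (S.U α β h)).symm)

variable [∀ α, CompleteSpace (H α)]

theorem V_proj {α β : F} (h : α ≤ β) (ξ : S.D) : S.V α β h (S.proj β ξ) = S.proj α ξ :=
  (ξ.2 α β h).symm

theorem norm_V_le {α β : F} (h : α ≤ β) (x : H β) : ‖S.V α β h x‖ ≤ ‖x‖ := by
  refine ((S.V α β h).le_of_opNorm_le (c := 1) ?_ x).trans_eq (one_mul _)
  rw [V, LinearIsometryEquiv.norm_map]
  exact (S.U α β h).opNorm_le_bound zero_le_one fun x => by simpa using S.contractive α β h x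

theorem norm_proj_mono {α β : F} (h : α ≤ β) (ξ : S.D) : ‖S.proj α ξ‖ ≤ ‖S.proj β ξ‖ :=
  S.V_proj h ξ ▸ S.norm_V_le h _

theorem denseRange_proj [IsDirectedOrder F] (hdual : S.IsDualPair) (α : F) :
    DenseRange (S.proj α) := by
  have : (LinearMap.range (S.proj α)).topologicalClosure = ⊤ := by
    rw [Submodule.topologicalClosure_eq_top_iff, Submodule.eq_bot_iff]
    intro x hx
    refine S.Theta_injective α ((hdual _ fun ξ => ?_).trans (map_zero (S.Theta α)).symm)
    rw [pairing_Theta]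
    exact hx _ ⟨ξ, rfl⟩
  exact Submodule.dense_iff_topologicalClosure_eq_top.2 this


/-- Riesz representation: a conjugate linear functional on `𝓓` bounded by the norm of `Π_α` is the
inner product with a vector of `H α`. -/
theorem exists_eq_inner_proj_of_bound {α : F} (hd : DenseRange (S.proj α)) (f : S.D →ₗ⋆[ℂ] ℂ)
    {c : ℝ} (hf : ∀ ξ, ‖f ξ‖ ≤ c * ‖S.proj α ξ‖) : ∃ x : H α, ∀ ξ, f ξ = ⟪S.proj α ξ, x⟫_ℂ := by
  let g : S.D →ₗ[ℂ] ℂ :=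
    { toFun := fun ξ => starRingEnd ℂ (f ξ)
      map_add' := fun ξ η => by rw [map_add, map_add]
      map_smul' := fun a ξ => by simp }
  have hg : ∃ c, ∀ ξ, ‖g ξ‖ ≤ c * ‖S.proj α ξ‖ := ⟨c, fun ξ => by simpa [g] using hf ξ⟩
  refine ⟨(InnerProductSpace.toDual ℂ (H α)).symm (g.extendOfNorm (S.proj α)), fun ξ => ?_⟩
  rw [← inner_conj_symm, InnerProductSpace.toDual_symm_apply, LinearMap.extendOfNorm_eq hd hg]
  simp [g]

theorem withSeminorms_projectiveTopology [Nonempty F] :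
    @WithSeminorms ℂ S.D F _ _ _ (fun α => (normSeminorm ℂ (H α)).comp (S.proj α))
      S.projectiveTopology := by
  let : TopologicalSpace S.D := S.projectiveTopology
  have : IsTopologicalAddGroup S.D :=
    topologicalAddGroup_iInf fun α => topologicalAddGroup_induced (S.proj α)
  rw [SeminormFamily.withSeminorms_iff_nhds_eq_iInf, nhds_iInf]
  refine iInf_congr fun α => ?_
  rw [nhds_induced, map_zero, ← comap_norm_nhds_zero, Filter.comap_comap]
  rfl

/-- The conjugate dual of `𝓓[t_p]` consists of the functionals `⟨Π_α ·, x⟩`: by directedness, a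
continuous functional is bounded by a single norm. -/
theorem continuous_projectiveTopology_iff [IsDirectedOrder F] [Nonempty F] (hdual : S.IsDualPair)
    (f : S.D →ₗ⋆[ℂ] ℂ) :
    Continuous[S.projectiveTopology, inferInstance] f ↔
      ∃ α, ∃ x : H α, ∀ ξ, f ξ = ⟪S.proj α ξ, x⟫_ℂ := by
  constructor
  · intro hf
    let : TopologicalSpace S.D := S.projectiveTopology
    let q : Seminorm ℂ S.D := (normSeminorm ℂ ℂ).comp f
    have hq : Continuous q := continuous_norm.comp hf
    obtain ⟨s, c, -, hc⟩ := Seminorm.bound_of_continuous S.withSeminorms_projectiveTopology q hq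
    obtain ⟨γ, hγ⟩ := s.exists_le
    refine ⟨γ, S.exists_eq_inner_proj_of_bound (S.denseRange_proj hdual γ) f (c := c) fun ξ => ?_⟩
    refine (hc ξ).trans ?_
    rw [_root_.smul_apply, NNReal.smul_def, smul_eq_mul]
    refine mul_le_mul_of_nonneg_left ?_ c.2
    exact Seminorm.finset_sup_apply_le (norm_nonneg _) fun α hα => S.norm_proj_mono (hγ α hα) ξ
  · rintro ⟨α, x, hf⟩
    rw [show (f : S.D → ℂ) = (fun y => ⟪y, x⟫_ℂ) ∘ S.proj α from funext hf]
    have h1 : Continuous[S.projectiveTopology, inferInstance] (S.proj α) :=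
      continuous_iInf_dom (i := α) continuous_induced_dom
    have h2 : Continuous fun y : H α => ⟪y, x⟫_ℂ := by fun_prop
    exact @Continuous.comp _ _ _ S.projectiveTopology _ _ _ _ h2 h1

/-- A linear functional on `𝓓^×` whose compositions with all `Θ_α` are continuous is represented,
by the Riesz theorem on each `H α`, by a compatible family of vectors, a point of `𝓓`. -/
theorem forall_continuous_comp_Theta_iff [IsDirectedOrder F] [Nonempty F] (f : S.Dx →ₗ[ℂ] ℂ) :
    (∀ α, Continuous fun x => f (S.Theta α x)) ↔ ∃ ξ : S.D, ∀ η, f η = S.pairing η ξ := by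
  constructor
  · intro hf
    let g : ∀ α, StrongDual ℂ (H α) := fun α => ⟨f ∘ₗ S.Theta α, hf α⟩
    let y : ∀ α, H α := fun α => (InnerProductSpace.toDual ℂ (H α)).symm (g α)
    have hy : ∀ α x, ⟪y α, x⟫_ℂ = f (S.Theta α x) := fun α x =>
      InnerProductSpace.toDual_symm_apply
    refine ⟨⟨y, fun α β h => ext_inner_right ℂ fun x => ?_⟩, fun η => ?_⟩
    · rw [V, ContinuousLinearMap.adjoint_inner_left, hy, hy, Theta_U]
    · obtain ⟨α, x, rfl⟩ := S.exists_Theta_eq η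
      rw [pairing_Theta]
      exact (hy α x).symm
  · rintro ⟨ξ, hξ⟩ α
    simp only [hξ, pairing_Theta]
    fun_prop

/-- The contraction `H α → H β` is the adjoint of the extension of `Π_β ξ ↦ Π_α ξ`. -/
theorem norm_proj_le_iff_exists_contraction [IsDirectedOrder F] (hdual : S.IsDualPair) (α β : F) :
    (∀ ξ, ‖S.proj α ξ‖ ≤ ‖S.proj β ξ‖) ↔
      ∃ U : H α →ₗ[ℂ] H β, (∀ x, ‖U x‖ ≤ ‖x‖) ∧ ∀ x, S.Theta β (U x) = S.Theta α x := by
  constructor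
  · intro h
    have h1 : ∀ ξ, ‖S.proj α ξ‖ ≤ 1 * ‖S.proj β ξ‖ := by simpa using h
    have hd := S.denseRange_proj hdual β
    let v : H β →L[ℂ] H α := (S.proj α).extendOfNorm (S.proj β)
    have hv : ∀ ξ, v (S.proj β ξ) = S.proj α ξ := LinearMap.extendOfNorm_eq hd ⟨1, h1⟩
    refine ⟨(ContinuousLinearMap.adjoint v : H α →ₗ[ℂ] H β), fun x => ?_, fun x => ?_⟩
    · refine ((ContinuousLinearMap.adjoint v).le_of_opNorm_le (c := 1) ?_ x).trans_eq (one_mul _)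
      rw [LinearIsometryEquiv.norm_map]
      exact LinearMap.opNorm_extendOfNorm_le hd zero_le_one h1
    · rw [← sub_eq_zero]
      refine hdual _ fun ξ => ?_
      rw [map_sub, LinearMap.sub_apply, pairing_Theta, pairing_Theta, sub_eq_zero, ← hv ξ]
      exact ContinuousLinearMap.adjoint_inner_right v _ _
  · rintro ⟨U, hU, hUΘ⟩ ξ
    have h : ⟪S.proj β ξ, U (S.proj α ξ)⟫_ℂ = ⟪S.proj α ξ, S.proj α ξ⟫_ℂ := by
      rw [← pairing_Theta, hUΘ, pairing_Theta]
    have h1 : ‖S.proj α ξ‖ * ‖S.proj α ξ‖ ≤ ‖S.proj β ξ‖ * ‖S.proj α ξ‖ := by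
      rw [← inner_self_eq_norm_mul_norm (𝕜 := ℂ), ← h]
      exact ((RCLike.re_le_norm _).trans (norm_inner_le_norm _ _)).trans
        (mul_le_mul_of_nonneg_left (hU _) (norm_nonneg _))
    rcases (norm_nonneg (S.proj α ξ)).eq_or_lt with h0 | h0
    · rw [← h0]
      exact norm_nonneg _
    · exact le_of_mul_le_mul_right h1 h0

section completion

variable {H₀ : Type*} [NormedAddCommGroup H₀] [InnerProductSpace ℂ H₀]
  {j : S.D →ₗ[ℂ] H₀}

variable {S} in
theorem IsCompletion₀.norm_le (hj : S.IsCompletion₀ j) (α : F) (ξ : S.D) :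
    ‖j ξ‖ ≤ ‖S.proj α ξ‖ := by
  rw [hj.2]
  exact ciInf_le ⟨0, by rintro _ ⟨β, rfl⟩; exact norm_nonneg _⟩ α

variable {S} in
theorem IsCompletion₀.injective (hj : S.IsCompletion₀ j) (hA : S.CondA) :
    Function.Injective j := by
  rw [injective_iff_map_eq_zero]
  intro ξ hξ
  exact hA ξ (by rw [← hj.2, hξ, norm_zero])

variable [CompleteSpace H₀]

variable (j) in
/-- The contraction `H α → H₀` that extends `Π_α ξ ↦ j ξ`. -/
def toCompletion (α : F) : H α →L[ℂ] H₀ := j.extendOfNorm (S.proj α)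

variable [IsDirectedOrder F] (hdual : S.IsDualPair) (hj : S.IsCompletion₀ j)
include hdual hj

theorem toCompletion_proj (α : F) (ξ : S.D) : S.toCompletion j α (S.proj α ξ) = j ξ :=
  LinearMap.extendOfNorm_eq (S.denseRange_proj hdual α)
    ⟨1, fun ξ => by simpa using hj.norm_le α ξ⟩ ξ

theorem norm_toCompletion_le (α : F) (x : H α) : ‖S.toCompletion j α x‖ ≤ ‖x‖ :=
  (LinearMap.norm_extendOfNorm_apply_le (S.denseRange_proj hdual α) 1
    (fun ξ => by simpa using hj.norm_le α ξ) x).trans_eq (one_mul _)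

theorem denseRange_toCompletion (α : F) : DenseRange (S.toCompletion j α) :=
  hj.1.mono (by rintro _ ⟨ξ, rfl⟩; exact ⟨_, S.toCompletion_proj hdual hj α ξ⟩)

/-- Condition (C) says exactly that the extension of `Π_α ξ ↦ j ξ` has trivial kernel. -/
theorem injective_toCompletion (hC : S.CondC) (α : F) :
    Function.Injective (S.toCompletion j α) := by
  rw [injective_iff_map_eq_zero]
  intro x hx
  obtain ⟨y, hy, hyx⟩ := mem_closure_iff_seq_limit.1 (S.denseRange_proj hdual α x)
  choose ξ hξ using hy
  obtain rfl : (fun n => S.proj α (ξ n)) = y := funext hξ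
  refine tendsto_nhds_unique hyx (hC α ξ ?_ hyx.cauchySeq)
  have h := (((S.toCompletion j α).continuous.tendsto x).comp hyx).norm
  rw [hx, norm_zero] at h
  refine h.congr fun n => ?_
  rw [← hj.2, Function.comp_apply, S.toCompletion_proj hdual hj]

theorem toCompletion_V {α β : F} (h : α ≤ β) (x : H β) :
    S.toCompletion j α (S.V α β h x) = S.toCompletion j β x := by
  refine (S.denseRange_proj hdual β).induction_on
    (p := fun x => S.toCompletion j α (S.V α β h x) = S.toCompletion j β x) x
    (isClosed_eq (by fun_prop) (by fun_prop)) fun ξ => ?_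
  rw [V_proj, S.toCompletion_proj hdual hj, S.toCompletion_proj hdual hj]

/-- A vector of `H₀` in the range of all the injections `H α → H₀` comes from a family of vectors
compatible with the maps `V_{αβ}`, that is, from `𝓓`. -/
theorem mem_range_iff_forall_mem_range [Nonempty F] (hC : S.CondC) (z : H₀) :
    z ∈ LinearMap.range j ↔ ∀ α, z ∈ Set.range (S.toCompletion j α) := by
  constructor
  · rintro ⟨ξ, rfl⟩ α
    exact ⟨_, S.toCompletion_proj hdual hj α ξ⟩
  · intro h
    choose y hy using h
    let ξ : S.D := ⟨y, fun α β h => S.injective_toCompletion hdual hj hC α (by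
      rw [S.toCompletion_V hdual hj, hy, hy])⟩
    obtain ⟨α⟩ := ‹Nonempty F›
    refine ⟨ξ, ?_⟩
    rw [← S.toCompletion_proj hdual hj α ξ]
    exact hy α

/-- For any fixed `α`, the map `Θ_α W_α*` embeds `H₀` into `𝓓^×`, where `W_α : H α → H₀` is the
injection `toCompletion`. -/
theorem exists_embedding_Dx [Nonempty F] :
    ∃ J : H₀ →ₗ[ℂ] S.Dx, Function.Injective J ∧ ∀ η ξ, S.pairing (J η) ξ = ⟪j ξ, η⟫_ℂ := by
  obtain ⟨α⟩ := ‹Nonempty F›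
  let J : H₀ →ₗ[ℂ] S.Dx :=
    S.Theta α ∘ₗ (ContinuousLinearMap.adjoint (S.toCompletion j α) : H₀ →ₗ[ℂ] H α)
  have hJ : ∀ η ξ, S.pairing (J η) ξ = ⟪j ξ, η⟫_ℂ := fun η ξ => by
    rw [← S.toCompletion_proj hdual hj α ξ, ← ContinuousLinearMap.adjoint_inner_right]
    exact S.pairing_Theta α _ ξ
  refine ⟨J, ?_, hJ⟩
  rw [injective_iff_map_eq_zero]
  intro η hη
  refine hj.1.eq_zero_of_inner_right ℂ ?_
  rintro ξ
  rw [← hJ, hη, map_zero, LinearMap.zero_apply]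

end completion

end ContractiveSystem

/-! ### Closable operators generating the spaces of a contractive system -/

namespace OFamily

section

variable {F : Type*} {K : Type*} [NormedAddCommGroup K] [InnerProductSpace ℂ K] (O : OFamily F K)

theorem cl_apply_of_mem_dom {α : F} (x : O.dom) (y : O.HA α) (h : (y : K) = x) :
    O.cl α y = O.op α x :=
  ((O.pmap α).le_closure.2 (x := x) (y := y) h.symm).symm

variable {H : F → Type*} [∀ α, NormedAddCommGroup (H α)] [∀ α, InnerProductSpace ℂ (H α)]
  {W : ∀ α, H α ≃ₗ[ℂ] O.HA α} (hW : ∀ α x, O.graphNorm α (W α x) = ‖x‖)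
include hW

theorem norm_sq_add_norm_cl_sq (α : F) (x : H α) :
    ‖(W α x : K)‖ ^ 2 + ‖O.cl α (W α x)‖ ^ 2 = ‖x‖ ^ 2 := by
  rw [← hW, graphNorm_apply, Real.sq_sqrt (by positivity)]

theorem inner_add_inner_cl (α : F) (x y : H α) :
    ⟪(W α x : K), (W α y : K)⟫_ℂ + ⟪O.cl α (W α x), O.cl α (W α y)⟫_ℂ = ⟪x, y⟫_ℂ := by
  let L : H α →ₗᵢ[ℂ] WithLp 2 (K × K) := ⟨O.graphMap α ∘ₗ (W α).toLinearMap, hW α⟩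
  rw [← L.inner_map_map, WithLp.prod_inner_apply]
  rfl

end

end OFamily

namespace ContractiveSystem

variable {F : Type*} [Preorder F] {H : F → Type*} [∀ α, NormedAddCommGroup (H α)]
  [∀ α, InnerProductSpace ℂ (H α)] [∀ α, CompleteSpace (H α)] (S : ContractiveSystem F H)
  {H₀ : Type*} [NormedAddCommGroup H₀] [InnerProductSpace ℂ H₀] {j : S.D →ₗ[ℂ] H₀}

/-- The operators `A_α` are the restrictions to `j(𝓓)` of `C R⁻¹`, where `R P` is the polar
decomposition of the injection `H α → H₀` and `C = (I - R²)^{1/2}`. The square root of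
`I + A_α* Ā_α` is `R⁻¹`. -/
theorem exists_oFamily [IsDirectedOrder F] [CompleteSpace H₀] (hdual : S.IsDualPair)
    (hj : S.IsCompletion₀ j) (hC : S.CondC) :
    ∃ (O : OFamily F H₀) (W : ∀ α, H α ≃ₗ[ℂ] O.HA α),
      O.dom = LinearMap.range j ∧
      (∀ α x, (W α x : H₀) = S.toCompletion j α x) ∧
      (∀ α x, O.graphNorm α (W α x) = ‖x‖) ∧
      ∀ α, ∃ T : H₀ →ₗ.[ℂ] H₀, LinearPMap.IsPosSqrt T (O.pmap α).onePlusAdjointClosure ∧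
          T.domain = O.HA α ∧
          ∀ (x : H α) (hx : (W α x : H₀) ∈ T.domain), ‖T ⟨W α x, hx⟩‖ = ‖x‖ := by
  have hWinj := fun α => S.injective_toCompletion hdual hj hC α
  have hWd := fun α => S.denseRange_toCompletion hdual hj α
  choose R C P hR hC' hRC hRP using fun α => (S.toCompletion j α).exists_polar (hWinj α)
    (hWd α) (S.norm_toCompletion_le hdual hj α)
  have hRd : ∀ α, DenseRange (R α) := fun α =>
    (hWd α).mono (by rintro _ ⟨x, rfl⟩; exact ⟨P α x, hRP α x⟩)
  have hRinj : ∀ α, Function.Injective (R α) := fun α y z h => by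
    obtain ⟨y, rfl⟩ := (P α).surjective y
    obtain ⟨z, rfl⟩ := (P α).surjective z
    rw [hRP, hRP] at h
    rw [hWinj α h]
  have hRproj : ∀ α ξ, R α (P α (S.proj α ξ)) = j ξ := fun α ξ => by
    rw [hRP, S.toCompletion_proj hdual hj]
  have hle : ∀ α, LinearMap.range j ≤ LinearMap.range (R α : H₀ →ₗ[ℂ] H₀) := by
    rintro α _ ⟨ξ, rfl⟩
    exact ⟨_, hRproj α ξ⟩
  let op : F → LinearMap.range j →ₗ[ℂ] H₀ := fun α =>
    (LinearPMap.mulInv (C α) (R α) (hRinj α)).toFun ∘ₗ Submodule.inclusion (hle α)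
  have hgraph : ∀ α, ∀ p : H₀ × H₀,
      p ∈ (⟨LinearMap.range j, op α⟩ : H₀ →ₗ.[ℂ] H₀).graph ↔
        ∃ ξ : S.D, R α (P α (S.proj α ξ)) = p.1 ∧ C α (P α (S.proj α ξ)) = p.2 := by
    intro α p
    have hop : ∀ ξ, op α ⟨j ξ, ξ, rfl⟩ = C α (P α (S.proj α ξ)) := fun ξ => by
      have hmem : R α (P α (S.proj α ξ)) ∈ LinearMap.range (R α : H₀ →ₗ[ℂ] H₀) := ⟨_, rfl⟩
      refine Eq.trans ?_ (LinearPMap.mulInv_apply (hR := hRinj α) (P α (S.proj α ξ)) hmem)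
      change LinearPMap.mulInv (C α) (R α) (hRinj α) _ = _
      congr 1
      exact Subtype.ext (hRproj α ξ).symm
    rw [LinearPMap.mem_graph_iff]
    constructor
    · rintro ⟨⟨_, ξ, rfl⟩, h1, h2⟩
      exact ⟨ξ, (hRproj α ξ).trans h1, (hop ξ).symm.trans h2⟩
    · rintro ⟨ξ, h1, h2⟩
      exact ⟨⟨j ξ, ξ, rfl⟩, (hRproj α ξ).symm.trans h1, (hop ξ).trans h2⟩
  let O : OFamily F H₀ :=
    { dom := LinearMap.range j
      dense := hj.1
      op := op
      closable := fun α => LinearPMap.isClosable_of_graph_eq (hRinj α) (hRC α) (hgraph α) }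
  have hcl : ∀ α, (O.pmap α).closure = LinearPMap.mulInv (C α) (R α) (hRinj α) := fun α =>
    LinearPMap.closure_eq_mulInv (hRC α)
      ((P α).surjective.denseRange.comp (S.denseRange_proj hdual α) (P α).continuous) (hgraph α)
  have hHA : ∀ α, O.HA α = LinearMap.range (R α : H₀ →ₗ[ℂ] H₀) := fun α =>
    congrArg LinearPMap.domain (hcl α)
  have hmem : ∀ α x, (S.toCompletion j α : H α →ₗ[ℂ] H₀) x ∈ O.HA α := fun α x => by
    rw [hHA]
    exact ⟨P α x, hRP α x⟩
  let W : ∀ α, H α ≃ₗ[ℂ] O.HA α := fun α =>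
    LinearEquiv.ofBijective ((S.toCompletion j α : H α →ₗ[ℂ] H₀).codRestrict (O.HA α) (hmem α))
      ⟨fun x y h => hWinj α (congrArg Subtype.val h), fun z => by
        obtain ⟨z, hz⟩ := z
        obtain ⟨y, rfl⟩ := (hHA α).le hz
        refine ⟨(P α).symm y, Subtype.ext ?_⟩
        exact (hRP α _).symm.trans (congrArg (R α) ((P α).apply_symm_apply y))⟩
  have hW : ∀ α x, (W α x : H₀) = S.toCompletion j α x := fun α x => rfl
  have hclW : ∀ α x, O.cl α (W α x) = C α (P α x) := fun α x => by
    obtain ⟨y, h1, h2⟩ := LinearPMap.mem_graph_mulInv.1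
      ((congrArg LinearPMap.graph (hcl α)).le ((O.pmap α).closure.mem_graph (W α x)))
    have hy : y = P α x := hRinj α (h1.trans (hRP α x).symm)
    rw [← hy]
    exact h2.symm
  refine ⟨O, W, rfl, hW, fun α x => ?_, fun α => ⟨LinearPMap.mulInv 1 (R α) (hRinj α),
    LinearPMap.isPosSqrt_onePlusAdjointClosure O.dense (O.closable α) (hcl α) (hR α) (hC' α)
      (hRd α) (hRC α), (hHA α).symm, fun x hx => ?_⟩⟩
  · rw [OFamily.graphNorm_apply, hclW, hW, ← hRP,
      norm_sq_add_norm_sq_of_comp_add_comp (hR α).isSelfAdjoint (hC' α) (hRC α),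
      LinearIsometryEquiv.norm_map, Real.sqrt_sq (norm_nonneg _)]
  · have hmem' : R α (P α x) ∈ (LinearPMap.mulInv 1 (R α) (hRinj α)).domain := ⟨_, rfl⟩
    have h : (⟨W α x, hx⟩ : (LinearPMap.mulInv 1 (R α) (hRinj α)).domain) =
        ⟨R α (P α x), hmem'⟩ := Subtype.ext (hRP α x).symm
    rw [h, LinearPMap.mulInv_apply]
    exact (P α).norm_map x

section identification

variable {S} {O : OFamily F H₀} {W : ∀ α, H α ≃ₗ[ℂ] O.HA α}

theorem coreIncl_eq {e : S.D ≃ₗ[ℂ] O.core} (hWj : ∀ α ξ, (W α (S.proj α ξ) : H₀) = j ξ)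
    (he : ∀ ξ, (e ξ : H₀) = j ξ) (α : F) (ξ : S.D) :
    O.coreIncl α (e ξ) = W α (S.proj α ξ) :=
  Subtype.ext ((he ξ).trans (hWj α ξ).symm)

variable (hWj : ∀ α ξ, (W α (S.proj α ξ) : H₀) = j ξ) (hW : ∀ α x, O.graphNorm α (W α x) = ‖x‖)
include hWj hW

/-- As `‖A_α j ξ‖² = ‖Π_α ξ‖² - ‖j ξ‖²`, the relation `⪯` orders the operators in the same way as
the norms `‖Π_α ξ‖` are ordered. -/
theorem prec_iff_norm_proj_le (hdom : O.dom = LinearMap.range j) (α β : F) :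
    O.Prec α β ↔ ∀ ξ, ‖S.proj α ξ‖ ≤ ‖S.proj β ξ‖ := by
  have hop : ∀ (γ : F) (ξ : S.D) (x : O.dom), (x : H₀) = j ξ →
      ‖j ξ‖ ^ 2 + ‖O.op γ x‖ ^ 2 = ‖S.proj γ ξ‖ ^ 2 := fun γ ξ x hx => by
    rw [← O.norm_sq_add_norm_cl_sq hW γ, hWj,
      O.cl_apply_of_mem_dom x _ ((hWj γ ξ).trans hx.symm)]
  constructor
  · intro h ξ
    have hmem : j ξ ∈ O.dom := hdom.ge ⟨ξ, rfl⟩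
    have h1 := pow_le_pow_left₀ (norm_nonneg _) (h ⟨j ξ, hmem⟩) 2
    refine (sq_le_sq₀ (norm_nonneg _) (norm_nonneg _)).1 ?_
    rw [← hop α ξ ⟨j ξ, hmem⟩ rfl, ← hop β ξ ⟨j ξ, hmem⟩ rfl]
    exact add_le_add_right h1 _
  · rintro h ⟨x, hx⟩
    obtain ⟨ξ, rfl⟩ := hdom.le hx
    have h1 := pow_le_pow_left₀ (norm_nonneg _) (h ξ) 2
    rw [← hop α ξ ⟨j ξ, hx⟩ rfl, ← hop β ξ ⟨j ξ, hx⟩ rfl] at h1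
    exact (sq_le_sq₀ (norm_nonneg _) (norm_nonneg _)).1 (le_of_add_le_add_left h1)

variable {e : S.D ≃ₗ[ℂ] O.core} (he : ∀ ξ, (e ξ : H₀) = j ξ)
include he

/-- Both topologies are defined by the same seminorms, as `‖e ξ‖_{A_α} = ‖Π_α ξ‖`. -/
theorem induced_graphTopology [Nonempty F] :
    TopologicalSpace.induced e O.graphTopology = S.projectiveTopology := by
  let : TopologicalSpace O.core := O.graphTopology
  have h1 := LinearMap.withSeminorms_induced
    (q := fun α => (O.graphNorm α).comp (O.coreIncl α)) ⟨rfl⟩ (e : S.D →ₗ[ℂ] O.core)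
  have h2 : SeminormFamily.comp (fun α => (O.graphNorm α).comp (O.coreIncl α))
      (e : S.D →ₗ[ℂ] O.core) = fun α => (normSeminorm ℂ (H α)).comp (S.proj α) := by
    funext α
    ext ξ
    change O.graphNorm α (O.coreIncl α (e ξ)) = ‖S.proj α ξ‖
    rw [coreIncl_eq hWj he, hW]
  rw [h2] at h1
  obtain ⟨h1⟩ := h1
  obtain ⟨h3⟩ := S.withSeminorms_projectiveTopology
  exact h1.trans h3.symm

/-- A functional continuous for the graph topology corresponds under `e` to one continuous for the
projective topology, hence to an element of some `H α`. -/
theorem exists_identification_Dx [IsDirectedOrder F] [Nonempty F] (hdual : S.IsDualPair) :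
    ∃ Φ : S.Dx →ₗ[ℂ] O.core →ₗ⋆[ℂ] ℂ,
      Function.Injective Φ ∧
      (∀ η ξ, Φ η (e ξ) = S.pairing η ξ) ∧
      (∀ α x, Φ (S.Theta α x) = O.Theta α (W α x)) ∧
      Set.range Φ = (⋃ α, Set.range (O.Theta α)) ∧
      Set.range Φ = O.conjDual := by
  let Φ : S.Dx →ₗ[ℂ] O.core →ₗ⋆[ℂ] ℂ :=
    { toFun := fun η => (S.pairing η).comp (e.symm : O.core →ₗ[ℂ] S.D)
      map_add' := fun η η' => by ext; simp
      map_smul' := fun c η => by ext; simp }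
  have hΦ : ∀ η ξ, Φ η (e ξ) = S.pairing η ξ := fun η ξ =>
    congrArg (S.pairing η) (e.symm_apply_apply ξ)
  have hΘ : ∀ α x, Φ (S.Theta α x) = O.Theta α (W α x) := fun α x => by
    refine LinearMap.ext fun z => ?_
    obtain ⟨ξ, rfl⟩ := e.surjective z
    rw [hΦ, pairing_Theta, ← O.inner_add_inner_cl hW, ← coreIncl_eq hWj he]
    rfl
  refine ⟨Φ, ?_, hΦ, hΘ, ?_, ?_⟩
  · rw [injective_iff_map_eq_zero]
    intro η hη
    exact hdual η fun ξ => by rw [← hΦ, hη, LinearMap.zero_apply]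
  · ext f
    rw [Set.mem_iUnion]
    constructor
    · rintro ⟨η, rfl⟩
      obtain ⟨α, x, rfl⟩ := S.exists_Theta_eq η
      exact ⟨α, W α x, (hΘ α x).symm⟩
    · rintro ⟨α, y, rfl⟩
      exact ⟨S.Theta α ((W α).symm y), by rw [hΘ, LinearEquiv.apply_symm_apply]⟩
  · ext f
    have hf : f ∈ O.conjDual ↔
        Continuous[S.projectiveTopology, inferInstance] (f.comp (e : S.D →ₗ[ℂ] O.core)) := by
      rw [← induced_graphTopology hWj hW he]
      constructor
      · intro h
        exact @Continuous.comp _ _ _ (_) O.graphTopology _ _ _ h continuous_induced_dom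
      · intro h
        have h1 : Continuous[O.graphTopology, TopologicalSpace.induced e O.graphTopology]
            e.symm := by
          rw [continuous_induced_rng]
          convert @continuous_id _ O.graphTopology
          ext z
          simp
        have h2 : (f : O.core → ℂ) = (f.comp (e : S.D →ₗ[ℂ] O.core)) ∘ e.symm := by
          ext z
          simp
        change Continuous[O.graphTopology, _] f
        rw [h2]
        exact @Continuous.comp _ _ _ O.graphTopology (_) _ _ _ h h1
    rw [hf, S.continuous_projectiveTopology_iff hdual]
    constructor
    · rintro ⟨η, rfl⟩
      obtain ⟨α, x, rfl⟩ := S.exists_Theta_eq η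
      exact ⟨α, x, fun ξ => (hΦ _ ξ).trans (S.pairing_Theta α x ξ)⟩
    · rintro ⟨α, x, hx⟩
      refine ⟨S.Theta α x, LinearMap.ext fun z => ?_⟩
      obtain ⟨ξ, rfl⟩ := e.surjective z
      rw [hΦ, pairing_Theta]
      exact (hx ξ).symm

end identification

end ContractiveSystem

end

theorem mainTheorem2 {F : Type*} [Preorder F] [IsDirectedOrder F] [Nonempty F]
    {H : F → Type*} [∀ α, NormedAddCommGroup (H α)] [∀ α, InnerProductSpace ℂ (H α)]
    [∀ α, CompleteSpace (H α)] (S : ContractiveSystem F H) (hdual : S.IsDualPair)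
    {H₀ : Type*} [NormedAddCommGroup H₀] [InnerProductSpace ℂ H₀] [CompleteSpace H₀]
    (j : S.D →ₗ[ℂ] H₀) (hj : S.IsCompletion₀ j) (hA : S.CondA) (hC : S.CondC) :
    -- `𝓓 ⊆ H₀ ⊆ 𝓓^×`
    Function.Injective j ∧
    (∃ J : H₀ →ₗ[ℂ] S.Dx, Function.Injective J ∧ ∀ η ξ, S.pairing (J η) ξ = ⟪j ξ, η⟫_ℂ) ∧
    -- closable operators `A_α` with domain `𝓓`, and isomorphisms `W α` of `H α` onto `H_{A_α}`
    ∃ (O : OFamily F H₀) (W : ∀ α, H α ≃ₗ[ℂ] O.HA α),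
      O.dom = LinearMap.range j ∧
      -- (i) `H α` is the completion of `𝓓` under `‖(I + A_α^* Ā_α)^{1/2} ξ‖₀`
      (∀ α,
        DenseRange (S.proj α) ∧
        (∀ ξ, (W α (S.proj α ξ) : H₀) = j ξ) ∧
        (∀ x, O.graphNorm α (W α x) = ‖x‖) ∧
        ∃ T : H₀ →ₗ.[ℂ] H₀, LinearPMap.IsPosSqrt T (O.pmap α).onePlusAdjointClosure ∧
          T.domain = O.HA α ∧
          ∀ (x : H α) (hx : (W α x : H₀) ∈ T.domain), ‖T ⟨W α x, hx⟩‖ = ‖x‖) ∧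
      -- for `α ≤ β`, `V_{αβ}` is the inclusion of `H_{A_β}` into `H_{A_α}`
      (∀ α β (h : α ≤ β) (x : H β), (W α (S.V α β h x) : H₀) = W β x) ∧
      -- (ii) the family is directed by the index set
      (∀ α β, α ≤ β → O.Prec α β) ∧
      (∀ α β, O.Prec α β ↔
        ∃ U : H α →ₗ[ℂ] H β, (∀ x, ‖U x‖ ≤ ‖x‖) ∧ ∀ x, S.Theta β (U x) = S.Theta α x) ∧
      -- (iii) `𝓓 = ⋂_α H_{A_α}`, with the same topology
      O.core = LinearMap.range j ∧
      (∃ e : S.D ≃ₗ[ℂ] O.core,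
        (∀ ξ, (e ξ : H₀) = j ξ) ∧
        TopologicalSpace.induced e O.graphTopology = S.projectiveTopology ∧
        -- `𝓓^× = ⋃_α Θ_{A_α}(H_{A_α})` is the conjugate dual of `𝓓` for the graph topology
        ∃ Φ : S.Dx →ₗ[ℂ] O.core →ₗ⋆[ℂ] ℂ,
          Function.Injective Φ ∧
          (∀ η ξ, Φ η (e ξ) = S.pairing η ξ) ∧
          (∀ α x, Φ (S.Theta α x) = O.Theta α (W α x)) ∧
          Set.range Φ = (⋃ α, Set.range (O.Theta α)) ∧
          Set.range Φ = O.conjDual) ∧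
      -- the inductive topology of `𝓓^×` is the Mackey topology `τ(𝓓^×, 𝓓)`
      IsMackeyTopology S.pairing S.inductiveTopology := by

  obtain ⟨O, W, hdom, hWe, hW, hT⟩ := S.exists_oFamily hdual hj hC
  have hWj : ∀ α ξ, (W α (S.proj α ξ) : H₀) = j ξ := fun α ξ => by
    rw [hWe, S.toCompletion_proj hdual hj]
  have hPrec := ContractiveSystem.prec_iff_norm_proj_le hWj hW hdom
  have hcore : O.core = LinearMap.range j := by
    ext z
    rw [S.mem_range_iff_forall_mem_range hdual hj hC, OFamily.core, Submodule.mem_iInf]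
    refine forall_congr' fun α => ⟨fun hz => ?_, ?_⟩
    · obtain ⟨x, hx⟩ := (W α).surjective ⟨z, hz⟩
      exact ⟨x, by rw [← hWe, hx]⟩
    · rintro ⟨x, rfl⟩
      rw [← hWe]
      exact (W α x).2
  have hinj := hj.injective hA
  let e : S.D ≃ₗ[ℂ] O.core :=
    (LinearEquiv.ofInjective j hinj).trans (LinearEquiv.ofEq _ _ hcore.symm)
  have he : ∀ ξ, (e ξ : H₀) = j ξ := fun ξ => rfl
  exact ⟨hinj, S.exists_embedding_Dx hdual hj, O, W, hdom,
    fun α => ⟨S.denseRange_proj hdual α, hWj α, hW α, hT α⟩,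
    fun α β h x => by rw [hWe, hWe, S.toCompletion_V hdual hj],
    fun α β h => (hPrec α β).2 (S.norm_proj_mono h),
    fun α β => (hPrec α β).trans (S.norm_proj_le_iff_exists_contraction hdual α β),
    hcore,
    ⟨e, he, ContractiveSystem.induced_graphTopology hWj hW he,
      ContractiveSystem.exists_identification_Dx hWj hW he hdual⟩,
    isMackeyTopology_sInf S.pairing S.Theta S.forall_continuous_comp_Theta_iff⟩
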